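/- Let $L$ be a loop, with left and right division $a\backslash b$ and $b/a$. Put $[a,b]=(ba)\backslash(ab)$ and $(a,b,c)=(a(bc))\backslash((ab)c)$. For a function $\phi:L^k\to L$ and $1\le i\le k$, the deviation derived from $\phi$ with respect to the $i$-th variable is the function $L^{k+1}\to L$, $$(x_1,\dots,x_{k+1})\mapsto \bigl(A(x_i)A(x_{i+1})\bigr)\backslash A(x_ix_{i+1}),\qquad A(a)=\phi(x_1,\dots,x_{i-1},a,x_{i+2},\dots,x_{k+1}).$$ The associator is the associator deviation of level $0$, and the associator deviations of level $l\geq 1$ are the deviations derived from those of level $l-1$ with respect to any of their $l+2$ variables. The commutator-associator filtration of $L$ is defined by $\gamma_1L=L$ and, for $n>1$, by letting $\gamma_nL$ be the minimal normal subloop of $L$ containing all $[a,b]$ with $a\in\gamma_pL$, $b\in\gamma_qL$, $p+q\ge n$, and all values of associator deviations of all levels $l\ge 0$ on arguments $a_j\in\gamma_{p_j}L$ $(1\le j\le l+3)$ with $p_1+\dots+p_{l+3}\ge n$, where all indices $p,q,p_j$ are positive integers smaller than $n$. A function $\phi:L^k\to L$ respects the filtration if, for all positive integers $n_1,\dots,n_k$,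 $x_i\in\gamma_{n_i}L$ for all $i$ implies $\phi(x_1,\dots,x_k)\in\gamma_{n_1+\dots+n_k}L$. It is regular if it respects the filtration and every deviation derived from it, with respect to any one of its variables, respects the filtration. **Proposition.** Let $w$ be an element of the free loop $F_k$ on $k$ generators and, for every loop $L$, let $\phi_w:L^k\to L$ be the function that sends $(x_1,\dots,x_k)$ to the image of $w$ under the homomorphism $F_k\to L$ taking the $i$-th generator to $x_i$. Suppose that $\phi_w$ respects the commutator-associator filtration on every loop $L$. Then, on every loop $L$, each deviation derived from $\phi_w$ with respect to any of its variables also respects the commutator-associator filtration; that is, $\phi_w$ is regular on every loop $L$. -/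

import Mathlib

universe u

/-- A loop: a set with a multiplication having a two-sided unit `1`, in which left division
`ldiv a b` (written `a \ b` in mathematics) and right division `b / a` exist and are unique. -/
class Loop (L : Type*) extends MulOneClass L, Div L where
  ldiv : L → L → L
  mul_ldiv (a b : L) : a * ldiv a b = b
  ldiv_mul (a b : L) : ldiv a (a * b) = b
  div_mul (a b : L) : b / a * a = b
  mul_div (a b : L) : b * a / a = b

namespace Loop

theorem image_sInter_eq {M : Type*} {f g : M → M} (hf : f.Injective) (hg : g.Injective) (C : Set (Set M))
    (hC : C.Nonempty) (h : ∀ N ∈ C, f '' N = g '' N) : f '' ⋂₀ C = g '' ⋂₀ C := by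
  rw [Set.sInter_eq_biInter, hf.injOn.image_biInter_eq hC, hg.injOn.image_biInter_eq hC]
  exact Set.iInter₂_congr h

variable {L : Type*} [Loop L]

/-- `N` is a normal subloop: a subloop with `xN = Nx`, `x(yN) = (xy)N` and `(Nx)y = N(xy)`
for all `x`, `y`. -/
structure IsNormalSubloop (N : Set L) : Prop where
  one_mem : 1 ∈ N
  mul_mem {a b : L} : a ∈ N → b ∈ N → a * b ∈ N
  ldiv_mem {a b : L} : a ∈ N → b ∈ N → ldiv a b ∈ N
  div_mem {a b : L} : a ∈ N → b ∈ N → a / b ∈ N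
  left_eq_right (x : L) : (fun n => x * n) '' N = (fun n => n * x) '' N
  left_assoc (x y : L) : (fun n => x * (y * n)) '' N = (fun n => (x * y) * n) '' N
  right_assoc (x y : L) : (fun n => (n * x) * y) '' N = (fun n => n * (x * y)) '' N

/-- The minimal normal subloop containing `S`. -/
def normalClosure (S : Set L) : Set L :=
  ⋂₀ {N | IsNormalSubloop N ∧ S ⊆ N}

theorem mul_left_cancel' {a b c : L} (h : a * b = a * c) : b = c := by
  rw [← ldiv_mul a b, h, ldiv_mul]

theorem mul_right_cancel' {a b c : L} (h : b * a = c * a) : b = c := by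
  rw [← mul_div a b, h, mul_div]

theorem isNormalSubloop_univ : IsNormalSubloop (Set.univ : Set L) where
  one_mem := trivial
  mul_mem _ _ := trivial
  ldiv_mem _ _ := trivial
  div_mem _ _ := trivial
  left_eq_right x := by
    rw [Set.image_univ_of_surjective fun b => ⟨ldiv x b, mul_ldiv x b⟩,
      Set.image_univ_of_surjective fun b => ⟨b / x, div_mul x b⟩]
  left_assoc x y := by
    rw [Set.image_univ_of_surjective fun b => ⟨ldiv y (ldiv x b), by simp [mul_ldiv]⟩,
      Set.image_univ_of_surjective fun b => ⟨ldiv (x * y) b, mul_ldiv _ b⟩]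
  right_assoc x y := by
    rw [Set.image_univ_of_surjective fun b => ⟨b / y / x, by simp [div_mul]⟩,
      Set.image_univ_of_surjective fun b => ⟨b / (x * y), div_mul _ b⟩]

/-- The normal closure is itself a normal subloop. -/
theorem isNormalSubloop_normalClosure (S : Set L) : IsNormalSubloop (normalClosure S) where
  one_mem := fun _ h => h.1.one_mem
  mul_mem ha hb := fun N h => h.1.mul_mem (ha N h) (hb N h)
  ldiv_mem ha hb := fun N h => h.1.ldiv_mem (ha N h) (hb N h)
  div_mem ha hb := fun N h => h.1.div_mem (ha N h) (hb N h)
  left_eq_right x := image_sInter_eq (fun _ _ h => mul_left_cancel' h)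
    (fun _ _ h => mul_right_cancel' h) _ ⟨Set.univ, isNormalSubloop_univ, Set.subset_univ _⟩
    fun _ h => h.1.left_eq_right x
  left_assoc x y := image_sInter_eq (fun _ _ h => mul_left_cancel' (mul_left_cancel' h))
    (fun _ _ h => mul_left_cancel' h) _ ⟨Set.univ, isNormalSubloop_univ, Set.subset_univ _⟩
    fun _ h => h.1.left_assoc x y
  right_assoc x y := image_sInter_eq (fun _ _ h => mul_right_cancel' (mul_right_cancel' h))
    (fun _ _ h => mul_right_cancel' h) _ ⟨Set.univ, isNormalSubloop_univ, Set.subset_univ _⟩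
    fun _ h => h.1.right_assoc x y

/-- The commutator `[a, b] = (ba) \ (ab)`. -/
def commutator (a b : L) : L := ldiv (b * a) (a * b)

/-- The associator `(a, b, c) = (a(bc)) \ ((ab)c)`. -/
def associator (a b c : L) : L := ldiv (a * (b * c)) ((a * b) * c)

/-- The deviation derived from `φ : L^k → L` with respect to its `i`-th variable. It is the
function of `k + 1` variables `x` whose value is `(A(x_i) A(x_{i+1})) \ A(x_i x_{i+1})`, where
`A(a) = φ(x_0, …, x_{i-1}, a, x_{i+2}, …, x_k)` (variables numbered from `0`). -/
def deviation {k : ℕ} (φ : (Fin k → L) → L) (i : Fin k) (x : Fin (k + 1) → L) : L :=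
  let A : L → L := fun a => φ (Function.update (i.succ.removeNth x) i a)
  ldiv (A (x i.castSucc) * A (x i.succ)) (A (x i.castSucc * x i.succ))

/-- The associator deviation of level `l` with indices `α_0, …, α_{l-1}` (numbered from `0`, so
that `α_j` ranges over `{0, …, j + 2}`). The associator is the associator deviation of level
zero. -/
def associatorDeviation :
    (l : ℕ) → ((j : Fin l) → Fin ((j : ℕ) + 3)) → (Fin (l + 3) → L) → L
  | 0, _ => fun x => associator (x 0) (x 1) (x 2)
  | l + 1, α => deviation (associatorDeviation l fun j => α j.castSucc) (α (Fin.last l))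

variable (L) in
/-- The `n`-th commutator-associator subloop `γ_n L`: `γ_1 L = L`, and for `n > 1` it is the minimal
normal subloop containing all commutators of elements of `γ_p L` and `γ_q L` with `p + q ≥ n` and
all values of the associator and of the associator deviations on arguments `x_j ∈ γ_{p_j} L` with
`∑ p_j ≥ n`. The indices are positive, and they may be taken smaller than `n`: a commutator,
associator or associator deviation with one argument in a normal subloop lies in that subloop, so
indices `≥ n` contribute nothing new. The value at `n = 0` is a convention only. -/
def gamma (n : ℕ) : Set L :=
  if n ≤ 1 then Set.univ
  else normalClosure
    ({z | ∃ (p q : ℕ) (_ : 1 ≤ p ∧ p < n) (_ : 1 ≤ q ∧ q < n),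
        n ≤ p + q ∧ ∃ a ∈ gamma p, ∃ b ∈ gamma q, z = commutator a b} ∪
     {z | ∃ (l : ℕ) (α : (j : Fin l) → Fin ((j : ℕ) + 3)) (p : Fin (l + 3) → ℕ)
        (_ : ∀ j, 1 ≤ p j ∧ p j < n),
        n ≤ ∑ j, p j ∧ ∃ x : Fin (l + 3) → L,
          (∀ j, x j ∈ gamma (p j)) ∧ z = associatorDeviation l α x})
termination_by n
decreasing_by all_goals grind

/-- `φ : L^k → L` respects the commutator-associator filtration of `L`. -/
def RespectsFiltration {k : ℕ} (φ : (Fin k → L) → L) : Prop :=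
  ∀ (n : Fin k → ℕ) (x : Fin k → L), (∀ i, 1 ≤ n i) → (∀ i, x i ∈ gamma L (n i)) →
    φ x ∈ gamma L (∑ i, n i)

/-- `φ : L^k → L` is regular: it respects the commutator-associator filtration, and so does every
deviation derived from it, with respect to any of its variables. -/
def IsRegular {k : ℕ} (φ : (Fin k → L) → L) : Prop :=
  RespectsFiltration φ ∧ ∀ i : Fin k, RespectsFiltration (deviation φ i)

end Loop

/-- Formal loop expressions in letters from `X`. -/
inductive LoopTerm (X : Type*)
  | of : X → LoopTerm X
  | one : LoopTerm X
  | mul : LoopTerm X → LoopTerm X → LoopTerm X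
  | ldiv : LoopTerm X → LoopTerm X → LoopTerm X
  | rdiv : LoopTerm X → LoopTerm X → LoopTerm X

namespace LoopTerm

/-- The loop identities, applied anywhere inside an expression. -/
inductive Rel {X : Type*} : LoopTerm X → LoopTerm X → Prop
  | one_mul (a) : Rel (mul one a) a
  | mul_one (a) : Rel (mul a one) a
  | mul_ldiv (a b) : Rel (mul a (ldiv a b)) b
  | ldiv_mul (a b) : Rel (ldiv a (mul a b)) b
  | div_mul (a b) : Rel (mul (rdiv b a) a) b
  | mul_div (a b) : Rel (rdiv (mul b a) a) b
  | mul_left {a b} (c) : Rel a b → Rel (mul a c) (mul b c)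
  | mul_right {a b} (c) : Rel a b → Rel (mul c a) (mul c b)
  | ldiv_left {a b} (c) : Rel a b → Rel (ldiv a c) (ldiv b c)
  | ldiv_right {a b} (c) : Rel a b → Rel (ldiv c a) (ldiv c b)
  | rdiv_left {a b} (c) : Rel a b → Rel (rdiv a c) (rdiv b c)
  | rdiv_right {a b} (c) : Rel a b → Rel (rdiv c a) (rdiv c b)

/-- The value of an expression in a loop, the letter `x` being replaced by `f x`. -/
def eval {X L : Type*} [Loop L] (f : X → L) : LoopTerm X → L
  | of x => f x
  | one => 1
  | mul a b => eval f a * eval f b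
  | ldiv a b => Loop.ldiv (eval f a) (eval f b)
  | rdiv a b => eval f a / eval f b

theorem eval_eq_of_rel {X L : Type*} [Loop L] (f : X → L) {a b : LoopTerm X} (h : Rel a b) :
    eval f a = eval f b := by
  induction h with
  | one_mul a => exact _root_.one_mul _
  | mul_one a => exact _root_.mul_one _
  | mul_ldiv a b => exact Loop.mul_ldiv _ _
  | ldiv_mul a b => exact Loop.ldiv_mul _ _
  | div_mul a b => exact Loop.div_mul _ _
  | mul_div a b => exact Loop.mul_div _ _
  | _ => simp_all [eval]

end LoopTerm

/-- The free loop on `X`: formal loop expressions modulo the congruence generated by the loop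
identities (`Quot` is the quotient by the equivalence relation generated by `Rel`). -/
def FreeLoop (X : Type*) : Type _ := Quot (LoopTerm.Rel (X := X))

namespace FreeLoop

variable {X : Type*}

/-- The generators of the free loop. -/
def of (x : X) : FreeLoop X := Quot.mk _ (.of x)

instance : Loop (FreeLoop X) where
  one := Quot.mk _ .one
  mul := Quot.map₂ .mul (fun c _ _ h => .mul_right c h) (fun _ _ c h => .mul_left c h)
  ldiv := Quot.map₂ .ldiv (fun c _ _ h => .ldiv_right c h) (fun _ _ c h => .ldiv_left c h)
  div := Quot.map₂ .rdiv (fun c _ _ h => .rdiv_right c h) (fun _ _ c h => .rdiv_left c h)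
  one_mul := by rintro ⟨a⟩; exact Quot.sound (.one_mul a)
  mul_one := by rintro ⟨a⟩; exact Quot.sound (.mul_one a)
  mul_ldiv := by rintro ⟨a⟩ ⟨b⟩; exact Quot.sound (.mul_ldiv a b)
  ldiv_mul := by rintro ⟨a⟩ ⟨b⟩; exact Quot.sound (.ldiv_mul a b)
  div_mul := by rintro ⟨a⟩ ⟨b⟩; exact Quot.sound (.div_mul a b)
  mul_div := by rintro ⟨a⟩ ⟨b⟩; exact Quot.sound (.mul_div a b)

/-- The homomorphism from the free loop on `X` to a loop `L` that extends `f : X → L`. -/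
def lift {L : Type*} [Loop L] (f : X → L) : FreeLoop X →* L where
  toFun := Quot.lift (LoopTerm.eval f) fun _ _ h => LoopTerm.eval_eq_of_rel f h
  map_one' := rfl
  map_mul' := by rintro ⟨a⟩ ⟨b⟩; rfl

end FreeLoop

/-- The function `φ_w : L^k → L` induced by an element `w` of the free loop on `k` generators. -/
def wordFun {k : ℕ} (w : FreeLoop (Fin k)) (L : Type*) [Loop L] (x : Fin k → L) : L :=
  FreeLoop.lift x w

/-!
The deviation `d` of `wordFun w` is induced by an element of the free loop on `k + 1` letters. A
function that respects the filtration is trivial, modulo every term of it, as soon as one of its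
arguments is `1`; the deviation inherits this property (`deviation_wordFun_mem_gamma`). So it is
enough to prove the following (`FreeLoop.lift_mem_gamma_of_kill`): if `d` in a free loop `F` becomes
arbitrarily deep in the filtration whenever a letter is set to `1`, then `d` evaluated at elements
`x_i` of `gamma L (n_i)` lies in `gamma L (∑ n_i)`.

To see this, call monomials the elements of `F` obtained from the letters by iterating commutators
and associator deviations. The quotient of `gamma F n` by `gamma F (n + 1)` is central in the
quotient of `F` by `gamma F (n + 1)`, and commutators and associator deviations are multiadditive on
these graded pieces, because their own deviations respect the filtration (`isRegular_commutator`,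
`isRegular_associatorDeviation`, `Loop.IsRegular.mem_spanMod`). By induction on `n`, the graded
pieces are generated by monomials (`FreeLoop.gamma_subset_spanMod_monomials`).

Now let `d` lie in `gamma F n` and write it, modulo `gamma F (n + 1)`, as a product of monomials of
degree `n`. Setting a letter to `1` kills the monomials that contain it and fixes the others. Hence
the factor of `d` made of the monomials without this letter is trivial modulo `gamma F (n + 1)`, and
dealing with the letters one by one leaves a product `v` of monomials that contain all letters
(`FreeLoop.mem_spanMod_monomials_of_kill`). Such monomials take values in `gamma L (∑ n_i)`, and the
argument continues with the quotient `v \ d`, which lies in `gamma F (n + 1)`. Once `n` has reached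
`∑ n_i`, the naturality of the filtration finishes the proof.
-/

namespace Loop

variable {L M : Type*} [Loop L] [Loop M]

/-! ### Homomorphisms -/

theorem eq_ldiv_of_mul_eq {a b c : L} (h : a * c = b) : c = ldiv a b := by
  rw [← h, ldiv_mul]

theorem eq_div_of_mul_eq {a b c : L} (h : c * a = b) : c = b / a := by
  rw [← h, mul_div]

theorem injective_mul_left (x : L) : (fun n => x * n).Injective := fun _ _ => mul_left_cancel'

theorem injective_mul_right (x : L) : (fun n => n * x).Injective := fun _ _ => mul_right_cancel'

theorem surjective_mul_left (x : L) : (fun n => x * n).Surjective := fun b => ⟨_, mul_ldiv x b⟩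

theorem surjective_mul_right (x : L) : (fun n => n * x).Surjective := fun b => ⟨_, div_mul x b⟩

theorem map_ldiv (h : L →* M) (a b : L) : h (ldiv a b) = ldiv (h a) (h b) :=
  eq_ldiv_of_mul_eq (by rw [← map_mul, mul_ldiv])

theorem map_div (h : L →* M) (a b : L) : h (a / b) = h a / h b :=
  eq_div_of_mul_eq (by rw [← map_mul, div_mul])

@[simp] theorem ldiv_self (a : L) : ldiv a a = 1 := (eq_ldiv_of_mul_eq (mul_one a)).symm

@[simp] theorem div_self (a : L) : a / a = 1 := (eq_div_of_mul_eq (one_mul a)).symm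

@[simp] theorem one_ldiv (a : L) : ldiv 1 a = a := (eq_ldiv_of_mul_eq (one_mul a)).symm

theorem ldiv_eq_one_iff {a b : L} : ldiv a b = 1 ↔ a = b :=
  ⟨fun h => by rw [← mul_ldiv a b, h, mul_one], fun h => by rw [h, ldiv_self]⟩

theorem map_commutator (h : L →* M) (a b : L) :
    h (commutator a b) = commutator (h a) (h b) := by
  simp [commutator, map_ldiv]

/-- Deviations are natural: a homomorphism that intertwines `φ` and `ψ` intertwines their
deviations. -/
theorem map_deviation (h : L →* M) {k : ℕ} {φ : (Fin k → L) → L} {ψ : (Fin k → M) → M}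
    (H : ∀ x, h (φ x) = ψ (h ∘ x)) (i : Fin k) (x : Fin (k + 1) → L) :
    h (deviation φ i x) = deviation ψ i (h ∘ x) := by
  have key (a : L) : h ∘ Function.update (i.succ.removeNth x) i a =
      Function.update (i.succ.removeNth (h ∘ x)) i (h a) := by
    rw [Function.comp_update]; rfl
  simp [deviation, map_ldiv, H, key]

theorem map_associatorDeviation (h : L →* M) :
    ∀ (l : ℕ) (α : (j : Fin l) → Fin ((j : ℕ) + 3)) (x : Fin (l + 3) → L),
      h (associatorDeviation l α x) = associatorDeviation l α (h ∘ x)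
  | 0, _, x => by simp [associatorDeviation, associator, map_ldiv]
  | l + 1, α, x => map_deviation h (map_associatorDeviation h l _) _ x

theorem commutator_eq_one_iff {a b : L} : commutator a b = 1 ↔ a * b = b * a := by
  rw [commutator, ldiv_eq_one_iff, eq_comm]

theorem associator_eq_one_iff {a b c : L} : associator a b c = 1 ↔ a * b * c = a * (b * c) := by
  rw [associator, ldiv_eq_one_iff, eq_comm]

/-- If `φ` is trivial whenever one of its arguments is, then so are its deviations. -/
theorem deviation_eq_one {k : ℕ} {φ : (Fin k → L) → L} (H : ∀ x j, x j = 1 → φ x = 1)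
    (i : Fin k) {x : Fin (k + 1) → L} {j : Fin (k + 1)} (hj : x j = 1) :
    deviation φ i x = 1 := by
  have hi (y : Fin k → L) : φ (Function.update y i 1) = 1 := H _ i (by simp)
  by_cases h1 : j = i.succ
  · subst h1
    simp [deviation, hj, hi]
  obtain ⟨j', rfl⟩ := Fin.exists_succAbove_eq h1
  by_cases h2 : j' = i
  · subst h2
    rw [Fin.succAbove_succ_self] at hj
    simp [deviation, hj, hi]
  · have h3 (a : L) : φ (Function.update (i.succ.removeNth x) i a) = 1 :=
      H _ j' (by simpa [Function.update_of_ne h2, Fin.removeNth] using hj)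
    simp [deviation, h3]

theorem associatorDeviation_eq_one :
    ∀ (l : ℕ) (α : (j : Fin l) → Fin ((j : ℕ) + 3)) (x : Fin (l + 3) → L) (j : Fin (l + 3)),
      x j = 1 → associatorDeviation l α x = 1
  | 0, _, x, j, hj => by
    rw [associatorDeviation, associator_eq_one_iff]
    fin_cases j <;> simp_all
  | l + 1, _, _, _, hj => deviation_eq_one (associatorDeviation_eq_one l _) _ hj

/-- The value of a deviation at arguments obtained from `x` by splitting the `i`-th one into `a`
and `b`. -/
theorem deviation_insertNth {k : ℕ} (φ : (Fin k → L) → L) (i : Fin k) (x : Fin k → L) (a b : L) :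
    deviation φ i (i.succ.insertNth (α := fun _ => L) b (Function.update x i a)) =
      ldiv (φ (Function.update x i a) * φ (Function.update x i b))
        (φ (Function.update x i (a * b))) := by
  have h : (i.succ.insertNth (α := fun _ => L) b (Function.update x i a)) i.castSucc = a := by
    rw [← Fin.succAbove_succ_self i, Fin.insertNth_apply_succAbove, Function.update_self]
  simp only [deviation, h, Fin.insertNth_apply_same, Fin.removeNth_insertNth,
    Function.update_idem]

/-! ### Quotient loops -/

namespace IsNormalSubloop

variable {N : Set L}

/-- Two elements are congruent modulo a normal subloop if they have the same left coset. -/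
def setoid (_ : IsNormalSubloop N) : Setoid L where
  r a b := (fun n => a * n) '' N = (fun n => b * n) '' N
  iseqv := ⟨fun _ => rfl, fun h => h.symm, fun h h' => h.trans h'⟩

theorem mul_coset_left (hN : IsNormalSubloop N) (a b : L) :
    (fun n => a * b * n) '' N = (fun n => a * n) '' ((fun n => b * n) '' N) := by
  rw [← hN.left_assoc, Set.image_image]

theorem mul_coset_right (hN : IsNormalSubloop N) (a b : L) :
    (fun n => a * b * n) '' N = (fun n => n * b) '' ((fun n => a * n) '' N) := by
  rw [hN.left_eq_right, ← hN.right_assoc, hN.left_eq_right, Set.image_image]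

theorem setoid_mul (hN : IsNormalSubloop N) {a a' b b' : L} (ha : hN.setoid a a')
    (hb : hN.setoid b b') : hN.setoid (a * b) (a' * b') := by
  change _ = _ at ha hb ⊢
  rw [hN.mul_coset_left, hb, ← hN.mul_coset_left, hN.mul_coset_right, ha, ← hN.mul_coset_right]

theorem setoid_cancel_left (hN : IsNormalSubloop N) {a a' b b' : L} (ha : hN.setoid a a')
    (h : hN.setoid (a * b) (a' * b')) : hN.setoid b b' := by
  have h2 := h.trans (hN.setoid_mul ha.symm (hN.setoid.refl b'))
  change _ = _ at h2 ⊢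
  rw [hN.mul_coset_left, hN.mul_coset_left] at h2
  exact Set.image_injective.2 (fun _ _ => mul_left_cancel') h2

theorem setoid_cancel_right (hN : IsNormalSubloop N) {a a' b b' : L} (hb : hN.setoid b b')
    (h : hN.setoid (a * b) (a' * b')) : hN.setoid a a' := by
  have h2 := h.trans (hN.setoid_mul (hN.setoid.refl a') hb.symm)
  change _ = _ at h2 ⊢
  rw [hN.mul_coset_right, hN.mul_coset_right] at h2
  exact Set.image_injective.2 (fun _ _ => mul_right_cancel') h2

/-- The quotient of a loop by a normal subloop. -/
def Quotient (hN : IsNormalSubloop N) : Type _ := _root_.Quotient hN.setoid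

instance (hN : IsNormalSubloop N) : Loop hN.Quotient where
  one := Quotient.mk hN.setoid 1
  mul := Quotient.map₂ (· * ·) fun _ _ ha _ _ hb => hN.setoid_mul ha hb
  ldiv := Quotient.map₂ ldiv fun a a' ha b b' hb => hN.setoid_cancel_left ha (by
    rwa [mul_ldiv, mul_ldiv])
  div := Quotient.map₂ (· / ·) fun a a' ha b b' hb => hN.setoid_cancel_right hb (by
    rwa [div_mul, div_mul])
  one_mul := by rintro ⟨a⟩; exact congrArg (Quotient.mk hN.setoid) (one_mul a)
  mul_one := by rintro ⟨a⟩; exact congrArg (Quotient.mk hN.setoid) (mul_one a)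
  mul_ldiv := by rintro ⟨a⟩ ⟨b⟩; exact congrArg (Quotient.mk hN.setoid) (mul_ldiv a b)
  ldiv_mul := by rintro ⟨a⟩ ⟨b⟩; exact congrArg (Quotient.mk hN.setoid) (ldiv_mul a b)
  div_mul := by rintro ⟨a⟩ ⟨b⟩; exact congrArg (Quotient.mk hN.setoid) (div_mul a b)
  mul_div := by rintro ⟨a⟩ ⟨b⟩; exact congrArg (Quotient.mk hN.setoid) (mul_div a b)

/-- The projection of a loop onto its quotient by a normal subloop. -/
def proj (hN : IsNormalSubloop N) : L →* hN.Quotient where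
  toFun := Quotient.mk hN.setoid
  map_one' := rfl
  map_mul' _ _ := rfl

theorem proj_surjective (hN : IsNormalSubloop N) : Function.Surjective hN.proj := by
  rintro ⟨a⟩; exact ⟨a, rfl⟩

theorem proj_eq_one_iff (hN : IsNormalSubloop N) {a : L} : hN.proj a = 1 ↔ a ∈ N := by
  refine (Quotient.eq (r := hN.setoid) (x := a) (y := 1)).trans ?_
  change (fun n => a * n) '' N = (fun n => 1 * n) '' N ↔ _
  simp only [one_mul, Set.image_id']
  refine ⟨fun h => h ▸ ⟨1, hN.one_mem, mul_one a⟩, fun h => Set.Subset.antisymm ?_ ?_⟩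
  · rintro _ ⟨n, hn, rfl⟩
    exact hN.mul_mem h hn
  · exact fun n hn => ⟨ldiv a n, hN.ldiv_mem h hn, mul_ldiv a n⟩

theorem proj_eq_proj_iff (hN : IsNormalSubloop N) {a b : L} : hN.proj a = hN.proj b ↔
    ldiv a b ∈ N := by
  rw [← proj_eq_one_iff, map_ldiv, ldiv_eq_one_iff]

theorem commutator_mem (hN : IsNormalSubloop N) {a b : L} (h : a ∈ N ∨ b ∈ N) :
    commutator a b ∈ N := by
  rw [← hN.proj_eq_one_iff, map_commutator, commutator_eq_one_iff]
  rcases h with h | h <;> simp [hN.proj_eq_one_iff.2 h]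

theorem associatorDeviation_mem (hN : IsNormalSubloop N) {l : ℕ}
    (α : (j : Fin l) → Fin ((j : ℕ) + 3)) {x : Fin (l + 3) → L} {j : Fin (l + 3)} (h : x j ∈ N) :
    associatorDeviation l α x ∈ N := by
  rw [← hN.proj_eq_one_iff, map_associatorDeviation]
  exact associatorDeviation_eq_one l α _ j (hN.proj_eq_one_iff.2 h)

/-- The preimage of a normal subloop under a homomorphism is normal. -/
theorem preimage {N : Set M} (hN : IsNormalSubloop N) (h : L →* M) :
    IsNormalSubloop (h ⁻¹' N) := by
  -- An equation `f n = g n'` in `L` puts `n` into the preimage as soon as `n'` is there.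
  have key {f g : L → L} {f' g' : M → M} (hf : ∀ n, h (f n) = f' (h n))
      (hg : ∀ n, h (g n) = g' (h n)) (hg' : g'.Injective) (hs : g.Surjective)
      (H : f' '' N ⊆ g' '' N) : f '' (h ⁻¹' N) ⊆ g '' (h ⁻¹' N) := by
    rintro _ ⟨n, hn, rfl⟩
    obtain ⟨n', e⟩ := hs (f n)
    obtain ⟨m, hm, e'⟩ := H ⟨h n, hn, rfl⟩
    refine ⟨n', ?_, e⟩
    rw [Set.mem_preimage, show h n' = m from hg' (by rw [← hg, e, hf, e'])]
    exact hm
  constructor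
  · simpa using hN.one_mem
  · intro a b ha hb
    simpa using hN.mul_mem ha hb
  · intro a b ha hb
    simpa [map_ldiv] using hN.ldiv_mem ha hb
  · intro a b ha hb
    simpa [map_div] using hN.div_mem ha hb
  · intro x
    have H := hN.left_eq_right (h x)
    exact (key (by simp) (by simp)
        (injective_mul_right _) (surjective_mul_right _) H.subset).antisymm
      (key (by simp) (by simp)
        (injective_mul_left _) (surjective_mul_left _) H.superset)
  · intro x y
    have H := hN.left_assoc (h x) (h y)
    exact (key (by simp) (by simp)
        (injective_mul_left _) (surjective_mul_left _) H.subset).antisymm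
      (key (by simp) (by simp)
        ((injective_mul_left _).comp (injective_mul_left _))
        ((surjective_mul_left _).comp (surjective_mul_left _)) H.superset)
  · intro x y
    have H := hN.right_assoc (h x) (h y)
    exact (key (by simp) (by simp)
        (injective_mul_right _) (surjective_mul_right _) H.subset).antisymm
      (key (by simp) (by simp)
        ((injective_mul_right _).comp (injective_mul_right _))
        ((surjective_mul_right _).comp (surjective_mul_right _)) H.superset)

/-- A subloop that is central modulo a smaller normal subloop `K`, and that contains with an
element everything congruent to it modulo `K`, is normal. -/
theorem of_isMulCentral {K : Set L} (hK : IsNormalSubloop K) {N : Set L}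
    (one_mem : 1 ∈ N) (mul_mem : ∀ {a b : L}, a ∈ N → b ∈ N → a * b ∈ N)
    (ldiv_mem : ∀ {a b : L}, a ∈ N → b ∈ N → ldiv a b ∈ N)
    (div_mem : ∀ {a b : L}, a ∈ N → b ∈ N → a / b ∈ N)
    (sat : ∀ {a b : L}, hK.proj a = hK.proj b → a ∈ N → b ∈ N)
    (central : ∀ a ∈ N, IsMulCentral (hK.proj a)) : IsNormalSubloop N := by
  -- If `f n = g n'` and `n` lies in `N`, then `n'` is congruent to `n`, since `f` and `g` agree on
  -- central elements modulo `K`.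
  have key {f g : L → L} {f' g' : hK.Quotient → hK.Quotient}
      (hf : ∀ n, hK.proj (f n) = f' (hK.proj n)) (hg : ∀ n, hK.proj (g n) = g' (hK.proj n))
      (hg' : g'.Injective) (hs : g.Surjective)
      (H : ∀ z, IsMulCentral z → f' z = g' z) : f '' N ⊆ g '' N := by
    rintro _ ⟨n, hn, rfl⟩
    obtain ⟨n', e⟩ := hs (f n)
    refine ⟨n', sat (hg' ?_) hn, e⟩
    rw [← hg n', e, hf, H _ (central n hn)]
  refine ⟨one_mem, mul_mem, ldiv_mem, div_mem, fun x => ?_, fun x y => ?_, fun x y => ?_⟩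
  · exact (key (by simp) (by simp)
        (injective_mul_right _) (surjective_mul_right _)
        fun z hz => (hz.comm (hK.proj x)).symm.eq).antisymm
      (key (by simp) (by simp)
        (injective_mul_left _) (surjective_mul_left _)
        fun z hz => (hz.comm (hK.proj x)).eq)
  · exact (key (by simp) (by simp)
        (injective_mul_left _) (surjective_mul_left _)
        fun z hz => (hz.right_assoc (hK.proj x) (hK.proj y)).symm).antisymm
      (key (by simp) (by simp)
        ((injective_mul_left _).comp (injective_mul_left _))
        ((surjective_mul_left _).comp (surjective_mul_left _))
        fun z hz => hz.right_assoc (hK.proj x) (hK.proj y))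
  · exact (key (by simp) (by simp)
        (injective_mul_right _) (surjective_mul_right _)
        fun z hz => (hz.left_assoc (hK.proj x) (hK.proj y)).symm).antisymm
      (key (by simp) (by simp)
        ((injective_mul_right _).comp (injective_mul_right _))
        ((surjective_mul_right _).comp (surjective_mul_right _))
        fun z hz => hz.left_assoc (hK.proj x) (hK.proj y))

end IsNormalSubloop

/-! ### The commutator-associator filtration -/

theorem subset_normalClosure (S : Set L) : S ⊆ normalClosure S :=
  Set.subset_sInter fun _ h => h.2

theorem normalClosure_subset {S N : Set L} (hN : IsNormalSubloop N) (h : S ⊆ N) :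
    normalClosure S ⊆ N :=
  Set.sInter_subset_of_mem ⟨hN, h⟩

theorem gamma_of_le_one {n : ℕ} (h : n ≤ 1) : gamma L n = Set.univ := by
  rw [gamma, if_pos h]

variable (L) in
theorem isNormalSubloop_gamma (n : ℕ) : IsNormalSubloop (gamma L n) := by
  rw [gamma]
  split_ifs
  · exact isNormalSubloop_univ
  · exact isNormalSubloop_normalClosure _

theorem commutator_mem_gamma_of_lt {n p q : ℕ} (hp : 1 ≤ p ∧ p < n) (hq : 1 ≤ q ∧ q < n)
    (h : n ≤ p + q) {a b : L} (ha : a ∈ gamma L p) (hb : b ∈ gamma L q) :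
    commutator a b ∈ gamma L n := by
  rw [gamma, if_neg (by omega)]
  exact subset_normalClosure _ (.inl ⟨p, q, hp, hq, h, a, ha, b, hb, rfl⟩)

theorem associatorDeviation_mem_gamma_of_lt {n l : ℕ} (α : (j : Fin l) → Fin ((j : ℕ) + 3))
    {p : Fin (l + 3) → ℕ} (hp : ∀ j, 1 ≤ p j ∧ p j < n) (h : n ≤ ∑ j, p j) {x : Fin (l + 3) → L}
    (hx : ∀ j, x j ∈ gamma L (p j)) : associatorDeviation l α x ∈ gamma L n := by
  rw [gamma, if_neg (by have := hp 0; omega)]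
  exact subset_normalClosure _ (.inr ⟨l, α, p, hp, h, x, hx, rfl⟩)

/-- To put `gamma L n` into a normal subloop, it is enough to do so with its generators. -/
theorem gamma_subset {n : ℕ} (hn : 1 < n) {N : Set L} (hN : IsNormalSubloop N)
    (hc : ∀ p q : ℕ, 1 ≤ p ∧ p < n → 1 ≤ q ∧ q < n → n ≤ p + q →
      ∀ a ∈ gamma L p, ∀ b ∈ gamma L q, commutator a b ∈ N)
    (ha : ∀ (l : ℕ) (α : (j : Fin l) → Fin ((j : ℕ) + 3)) (p : Fin (l + 3) → ℕ),
      (∀ j, 1 ≤ p j ∧ p j < n) → n ≤ ∑ j, p j → ∀ x : Fin (l + 3) → L,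
        (∀ j, x j ∈ gamma L (p j)) → associatorDeviation l α x ∈ N) : gamma L n ⊆ N := by
  rw [gamma, if_neg (by omega)]
  refine normalClosure_subset hN ?_
  rintro z (⟨p, q, hp, hq, h, a, ha, b, hb, rfl⟩ | ⟨l, α, p, hp, h, x, hx, rfl⟩)
  · exact hc p q hp hq h a ha b hb
  · exact ha l α p hp h x hx

theorem gamma_succ_subset (n : ℕ) : gamma L (n + 1) ⊆ gamma L n := by
  by_cases hn : n ≤ 1
  · rw [gamma_of_le_one hn]
    exact Set.subset_univ _
  have hN := isNormalSubloop_gamma L n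
  refine gamma_subset (by omega) hN ?_ ?_
  · intro p q hp hq h a ha b hb
    by_cases h1 : p = n
    · exact hN.commutator_mem (.inl (h1 ▸ ha))
    by_cases h2 : q = n
    · exact hN.commutator_mem (.inr (h2 ▸ hb))
    exact commutator_mem_gamma_of_lt (by omega) (by omega) (by omega) ha hb
  · intro l α p hp h x hx
    by_cases h1 : ∃ j, p j = n
    · obtain ⟨j, hj⟩ := h1
      exact hN.associatorDeviation_mem α (j := j) (hj ▸ hx j)
    · push Not at h1
      exact associatorDeviation_mem_gamma_of_lt α
        (fun j => ⟨(hp j).1, by have := hp j; have := h1 j; omega⟩) (by omega) hx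

variable (L) in
theorem gamma_antitone : Antitone (gamma L) :=
  antitone_nat_of_succ_le gamma_succ_subset

theorem commutator_mem_gamma {p q : ℕ} (hp : 1 ≤ p) (hq : 1 ≤ q) {a b : L} (ha : a ∈ gamma L p)
    (hb : b ∈ gamma L q) : commutator a b ∈ gamma L (p + q) :=
  commutator_mem_gamma_of_lt (by omega) (by omega) le_rfl ha hb

theorem respectsFiltration_associatorDeviation (l : ℕ) (α : (j : Fin l) → Fin ((j : ℕ) + 3)) :
    RespectsFiltration (L := L) (associatorDeviation l α) := by
  intro p x hp hx
  refine associatorDeviation_mem_gamma_of_lt α (fun j => ⟨hp j, ?_⟩) le_rfl hx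
  -- There are at least three summands and each of them is positive.
  obtain ⟨j', hj'⟩ := exists_ne j
  have h := Finset.sum_le_sum_of_subset (f := p) (Finset.subset_univ {j, j'})
  rw [Finset.sum_pair hj'.symm] at h
  have := hp j'
  omega

theorem associator_mem_gamma {p q r : ℕ} (hp : 1 ≤ p) (hq : 1 ≤ q) (hr : 1 ≤ r) {a b c : L}
    (ha : a ∈ gamma L p) (hb : b ∈ gamma L q) (hc : c ∈ gamma L r) :
    associator a b c ∈ gamma L (p + q + r) := by
  have h := respectsFiltration_associatorDeviation (L := L) 0 (fun j => j.elim0)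
    ![p, q, r] ![a, b, c]
    (by intro i; fin_cases i <;> assumption) (by intro i; fin_cases i <;> assumption)
  simpa [associatorDeviation, Fin.sum_univ_three] using h

theorem map_mem_gamma (h : L →* M) (n : ℕ) : ∀ a ∈ gamma L n, h a ∈ gamma M n := by
  induction n using Nat.strong_induction_on with
  | _ n ih =>
    by_cases hn : n ≤ 1
    · simp [gamma_of_le_one hn]
    suffices gamma L n ⊆ h ⁻¹' gamma M n from this
    refine gamma_subset (by omega) ((isNormalSubloop_gamma M n).preimage h) ?_ ?_
    · intro p q hp hq hpq a ha b hb
      rw [Set.mem_preimage, map_commutator]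
      exact commutator_mem_gamma_of_lt hp hq hpq (ih p hp.2 a ha) (ih q hq.2 b hb)
    · intro l α p hp hpn x hx
      rw [Set.mem_preimage, map_associatorDeviation]
      exact associatorDeviation_mem_gamma_of_lt α hp hpn fun j => ih _ (hp j).2 _ (hx j)

/-! ### The quotients by the terms of the filtration -/

variable (L) in
/-- The projection of `L` onto the quotient by `gamma L n`. -/
abbrev gammaProj (n : ℕ) : L →* (isNormalSubloop_gamma L n).Quotient :=
  (isNormalSubloop_gamma L n).proj

theorem gammaProj_eq_one_iff {n : ℕ} {a : L} : gammaProj L n a = 1 ↔ a ∈ gamma L n :=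
  (isNormalSubloop_gamma L n).proj_eq_one_iff

theorem gammaProj_eq_iff {n : ℕ} {a b : L} :
    gammaProj L n a = gammaProj L n b ↔ ldiv a b ∈ gamma L n :=
  (isNormalSubloop_gamma L n).proj_eq_proj_iff

theorem gammaProj_map (h : L →* M) {n : ℕ} {a b : L} (hab : gammaProj L n a = gammaProj L n b) :
    gammaProj M n (h a) = gammaProj M n (h b) := by
  rw [gammaProj_eq_iff] at hab ⊢
  rw [← map_ldiv]
  exact map_mem_gamma h n _ hab

theorem mem_gamma_of_gammaProj_eq {m n : ℕ} (hmn : m ≤ n) {a b : L}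
    (hab : gammaProj L n a = gammaProj L n b) (ha : a ∈ gamma L m) : b ∈ gamma L m := by
  rw [← mul_ldiv a b]
  exact (isNormalSubloop_gamma L m).mul_mem ha (gamma_antitone L hmn (gammaProj_eq_iff.1 hab))

theorem gammaProj_mul_comm {n p q : ℕ} (hp : 1 ≤ p) (hq : 1 ≤ q) (hn : n ≤ p + q) {a b : L}
    (ha : a ∈ gamma L p) (hb : b ∈ gamma L q) :
    gammaProj L n a * gammaProj L n b = gammaProj L n b * gammaProj L n a := by
  rw [← commutator_eq_one_iff, ← map_commutator, gammaProj_eq_one_iff]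
  exact gamma_antitone L hn (commutator_mem_gamma hp hq ha hb)

theorem gammaProj_mul_assoc {n p q r : ℕ} (hp : 1 ≤ p) (hq : 1 ≤ q) (hr : 1 ≤ r)
    (hn : n ≤ p + q + r) {a b c : L} (ha : a ∈ gamma L p) (hb : b ∈ gamma L q)
    (hc : c ∈ gamma L r) :
    gammaProj L n a * gammaProj L n b * gammaProj L n c =
      gammaProj L n a * (gammaProj L n b * gammaProj L n c) := by
  simp only [← map_mul]
  rw [eq_comm, gammaProj_eq_iff]
  exact gamma_antitone L hn (associator_mem_gamma hp hq hr ha hb hc)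

theorem mem_gamma_one (a : L) : a ∈ gamma L 1 := by
  simp [gamma_of_le_one le_rfl]

/-- The `n`-th term of the filtration is central modulo the next one. -/
theorem isMulCentral_gammaProj {n : ℕ} (hn : 1 ≤ n) {z : L} (hz : z ∈ gamma L n) :
    IsMulCentral (gammaProj L (n + 1) z) := by
  have hs := (isNormalSubloop_gamma L (n + 1)).proj_surjective
  refine ⟨hs.forall.2 fun a => ?_, hs.forall₂.2 fun a b => ?_, hs.forall₂.2 fun a b => ?_⟩
  · exact gammaProj_mul_comm hn le_rfl le_rfl hz (mem_gamma_one a)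
  · exact (gammaProj_mul_assoc hn le_rfl le_rfl (by omega) hz (mem_gamma_one a)
      (mem_gamma_one b)).symm
  · exact gammaProj_mul_assoc le_rfl le_rfl hn (by omega) (mem_gamma_one a) (mem_gamma_one b) hz

/-! ### Regularity of commutators and associator deviations -/

theorem isRegular_associatorDeviation (l : ℕ) (α : (j : Fin l) → Fin ((j : ℕ) + 3)) :
    IsRegular (L := L) (associatorDeviation l α) := by
  refine ⟨respectsFiltration_associatorDeviation l α, fun i => ?_⟩
  have h := respectsFiltration_associatorDeviation (L := L) (l + 1)
    (Fin.snoc (α := fun j => Fin ((j : ℕ) + 3)) α i)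
  simpa [associatorDeviation] using h

/-- The commutator is multiplicative in its first argument up to higher terms of the filtration. -/
theorem commutator_mul_left {p p' q : ℕ} (hp : 1 ≤ p) (hp' : 1 ≤ p') (hq : 1 ≤ q) {a b c : L}
    (ha : a ∈ gamma L p) (hb : b ∈ gamma L p') (hc : c ∈ gamma L q) :
    ldiv (commutator a c * commutator b c) (commutator (a * b) c) ∈ gamma L (p + p' + q) := by
  have hu := commutator_mem_gamma hp hq ha hc
  have hv := commutator_mem_gamma hp' hq hb hc
  have eu : c * a * commutator a c = a * c := mul_ldiv _ _
  have ev : c * b * commutator b c = b * c := mul_ldiv _ _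
  generalize commutator a c = u at *
  generalize commutator b c = v at *
  rw [← gammaProj_eq_iff]
  set π := gammaProj L (p + p' + q)
  have h1 : π (a * b * c) = π a * (π b * π c) := by
    simpa using gammaProj_mul_assoc hp hp' hq le_rfl ha hb hc
  have h2 : π a * (π (c * b) * π v) = π a * π (c * b) * π v :=
    (gammaProj_mul_assoc hp le_rfl (by omega) (by omega) ha (mem_gamma_one _) hv).symm
  have h3 : π a * (π c * π b) = π a * π c * π b :=
    (gammaProj_mul_assoc hp hq hp' (by omega) ha hc hb).symm
  have h4 : π (c * a) * π u * π b = π (c * a) * (π u * π b) :=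
    gammaProj_mul_assoc le_rfl (by omega) hp' (by omega) (mem_gamma_one _) hu hb
  have h5 : π u * π b = π b * π u :=
    gammaProj_mul_comm (by omega) hp' (by omega) hu hb
  have h6 : π (c * a) * (π b * π u) = π (c * a) * π b * π u :=
    (gammaProj_mul_assoc le_rfl hp' (by omega) (by omega) (mem_gamma_one _) hb hu).symm
  have h7 : π c * π a * π b = π c * (π a * π b) :=
    gammaProj_mul_assoc hq hp hp' (by omega) hc ha hb
  have h8 : π (c * (a * b)) * π u * π v = π (c * (a * b)) * (π u * π v) :=
    gammaProj_mul_assoc le_rfl (by omega) (by omega) (by omega) (mem_gamma_one _) hu hv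
  have key : π (a * b * c) = π (c * (a * b) * (u * v)) := by
    calc π (a * b * c) = π a * (π (c * b) * π v) := by rw [h1, ← map_mul, ← ev, map_mul]
      _ = π a * π c * π b * π v := by rw [h2, map_mul, h3]
      _ = π (c * a) * π u * π b * π v := by rw [← map_mul, ← eu, map_mul]
      _ = π (c * a) * π b * π u * π v := by rw [h4, h5, h6]
      _ = π (c * (a * b) * (u * v)) := by rw [map_mul π c a, h7]; simpa using h8
  rw [commutator, map_ldiv, key, ← map_ldiv, ldiv_mul]

/-- The commutator is multiplicative in its second argument up to higher terms of the
filtration. -/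
theorem commutator_mul_right {p q q' : ℕ} (hp : 1 ≤ p) (hq : 1 ≤ q) (hq' : 1 ≤ q') {a b c : L}
    (ha : a ∈ gamma L p) (hb : b ∈ gamma L q) (hc : c ∈ gamma L q') :
    ldiv (commutator a b * commutator a c) (commutator a (b * c)) ∈ gamma L (p + q + q') := by
  have hu := commutator_mem_gamma hp hq ha hb
  have hv := commutator_mem_gamma hp hq' ha hc
  have eu : b * a * commutator a b = a * b := mul_ldiv _ _
  have ev : c * a * commutator a c = a * c := mul_ldiv _ _
  generalize commutator a b = u at *
  generalize commutator a c = v at *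
  rw [← gammaProj_eq_iff]
  set π := gammaProj L (p + q + q')
  have h1 : π (a * (b * c)) = π a * π b * π c := by
    simpa using (gammaProj_mul_assoc hp hq hq' le_rfl ha hb hc).symm
  have h2 : π (b * a) * π u * π c = π (b * a) * (π u * π c) :=
    gammaProj_mul_assoc le_rfl (by omega) hq' (by omega) (mem_gamma_one _) hu hc
  have h3 : π u * π c = π c * π u :=
    gammaProj_mul_comm (by omega) hq' (by omega) hu hc
  have h4 : π (b * a) * (π c * π u) = π (b * a) * π c * π u :=
    (gammaProj_mul_assoc le_rfl hq' (by omega) (by omega) (mem_gamma_one _) hc hu).symm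
  have h5 : π b * π a * π c = π b * (π a * π c) :=
    gammaProj_mul_assoc hq hp hq' (by omega) hb ha hc
  have h6 : π b * (π (c * a) * π v) = π b * π (c * a) * π v :=
    (gammaProj_mul_assoc hq le_rfl (by omega) (by omega) hb (mem_gamma_one _) hv).symm
  have h7 : π b * (π c * π a) = π b * π c * π a :=
    (gammaProj_mul_assoc hq hq' hp (by omega) hb hc ha).symm
  have h8 : π (b * c * a) * π v * π u = π (b * c * a) * (π v * π u) :=
    gammaProj_mul_assoc le_rfl (by omega) (by omega) (by omega) (mem_gamma_one _) hv hu
  have h9 : π v * π u = π u * π v :=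
    gammaProj_mul_comm (by omega) (by omega) (by omega) hv hu
  have key : π (a * (b * c)) = π (b * c * a * (u * v)) := by
    calc π (a * (b * c)) = π (b * a) * π u * π c := by rw [h1, ← map_mul, ← eu, map_mul]
      _ = π b * (π a * π c) * π u := by rw [h2, h3, h4, map_mul, h5]
      _ = π b * (π (c * a) * π v) * π u := by rw [← map_mul π a, ← ev, map_mul]
      _ = π b * π c * π a * π v * π u := by rw [h6, map_mul π c, h7]
      _ = π (b * c * a * (u * v)) := by
        rw [map_mul π _ (u * v), map_mul π u, ← h9, ← h8]; simp
  rw [commutator, map_ldiv, key, ← map_ldiv, ldiv_mul]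

theorem isRegular_commutator : IsRegular (L := L) fun x : Fin 2 → L => commutator (x 0) (x 1) := by
  refine ⟨fun n x hn hx => ?_, fun i => ?_⟩
  · rw [Fin.sum_univ_two]
    exact commutator_mem_gamma (hn 0) (hn 1) (hx 0) (hx 1)
  · intro n x hn hx
    rw [Fin.sum_univ_three]
    fin_cases i
    · simpa [deviation, Fin.removeNth, Function.update, Fin.succAbove] using
        commutator_mul_left (hn 0) (hn 1) (hn 2) (hx 0) (hx 1) (hx 2)
    · simpa [deviation, Fin.removeNth, Function.update, Fin.succAbove] using
        commutator_mul_right (hn 0) (hn 1) (hn 2) (hx 0) (hx 1) (hx 2)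

/-! ### Generators of the graded pieces of the filtration -/

/-- Membership in the subloop generated by a set. -/
inductive SubloopClosure (S : Set L) : L → Prop
  | of {a} : a ∈ S → SubloopClosure S a
  | one : SubloopClosure S 1
  | mul {a b} : SubloopClosure S a → SubloopClosure S b → SubloopClosure S (a * b)
  | ldiv {a b} : SubloopClosure S a → SubloopClosure S b → SubloopClosure S (ldiv a b)
  | div {a b} : SubloopClosure S a → SubloopClosure S b → SubloopClosure S (a / b)

theorem SubloopClosure.mem {S N : Set L} (hN : IsNormalSubloop N) (hS : S ⊆ N) {a : L}
    (ha : SubloopClosure S a) : a ∈ N := by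
  induction ha with
  | of h => exact hS h
  | one => exact hN.one_mem
  | mul _ _ h h' => exact hN.mul_mem h h'
  | ldiv _ _ h h' => exact hN.ldiv_mem h h'
  | div _ _ h h' => exact hN.div_mem h h'

/-- The elements congruent modulo `gamma L (n + 1)` to an element of the subloop generated
by `S`. -/
def spanMod (S : Set L) (n : ℕ) : Set L :=
  {z | ∃ v, SubloopClosure S v ∧ gammaProj L (n + 1) v = gammaProj L (n + 1) z}

section spanMod

variable {S : Set L} {n : ℕ} {a b : L}

theorem subset_spanMod : S ⊆ spanMod S n := fun a ha => ⟨a, .of ha, rfl⟩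

theorem spanMod_congr (h : gammaProj L (n + 1) a = gammaProj L (n + 1) b)
    (ha : a ∈ spanMod S n) : b ∈ spanMod S n := by
  obtain ⟨v, hv, e⟩ := ha
  exact ⟨v, hv, e.trans h⟩

theorem gamma_subset_spanMod : gamma L (n + 1) ⊆ spanMod S n := fun a ha =>
  ⟨1, .one, by rw [map_one, gammaProj_eq_one_iff.2 ha]⟩

theorem mul_mem_spanMod (ha : a ∈ spanMod S n) (hb : b ∈ spanMod S n) : a * b ∈ spanMod S n := by
  obtain ⟨v, hv, e⟩ := ha
  obtain ⟨w, hw, e'⟩ := hb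
  exact ⟨_, hv.mul hw, by simp [e, e']⟩

theorem ldiv_mem_spanMod (ha : a ∈ spanMod S n) (hb : b ∈ spanMod S n) :
    ldiv a b ∈ spanMod S n := by
  obtain ⟨v, hv, e⟩ := ha
  obtain ⟨w, hw, e'⟩ := hb
  exact ⟨_, hv.ldiv hw, by simp [map_ldiv, e, e']⟩

theorem div_mem_spanMod (ha : a ∈ spanMod S n) (hb : b ∈ spanMod S n) : a / b ∈ spanMod S n := by
  obtain ⟨v, hv, e⟩ := ha
  obtain ⟨w, hw, e'⟩ := hb
  exact ⟨_, hv.div hw, by simp [map_div, e, e']⟩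

theorem spanMod_subset_gamma (hS : S ⊆ gamma L n) : spanMod S n ⊆ gamma L n := by
  rintro z ⟨v, hv, e⟩
  exact mem_gamma_of_gammaProj_eq n.le_succ e (hv.mem (isNormalSubloop_gamma L n) hS)

theorem isNormalSubloop_spanMod (hn : 1 ≤ n) (hS : S ⊆ gamma L n) :
    IsNormalSubloop (spanMod S n) :=
  .of_isMulCentral (isNormalSubloop_gamma L (n + 1)) ⟨1, .one, rfl⟩ mul_mem_spanMod
    ldiv_mem_spanMod div_mem_spanMod spanMod_congr
    fun _ ha => isMulCentral_gammaProj hn (spanMod_subset_gamma hS ha)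

end spanMod

/-- A regular function is multiadditive on the graded pieces of the filtration. Here this is
expressed for one argument: if the values at generators lie in `spanMod T n`, so do
all the values. -/
theorem IsRegular.update_mem_spanMod {k : ℕ} {φ : (Fin k → L) → L} (hφ : IsRegular φ)
    {p : Fin k → ℕ} (hp : ∀ j, 1 ≤ p j) {i : Fin k} {S : Set L} (hS : S ⊆ gamma L (p i))
    (hS' : gamma L (p i) ⊆ spanMod S (p i)) {T : Set L} {z : Fin k → L}
    (hz : ∀ j, z j ∈ gamma L (p j))
    (H : ∀ s ∈ S, φ (Function.update z i s) ∈ spanMod T (∑ j, p j)) {a : L}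
    (ha : a ∈ gamma L (p i)) : φ (Function.update z i a) ∈ spanMod T (∑ j, p j) := by
  have hadd {a b : L} (ha : a ∈ gamma L (p i)) (hb : b ∈ gamma L (p i)) :
      gammaProj L (∑ j, p j + 1) (φ (Function.update z i a) * φ (Function.update z i b)) =
        gammaProj L (∑ j, p j + 1) (φ (Function.update z i (a * b))) := by
    rw [gammaProj_eq_iff, ← deviation_insertNth]
    have h := hφ.2 i (i.succ.insertNth (α := fun _ => ℕ) (p i) p)
      (i.succ.insertNth (α := fun _ => L) b (Function.update z i a))
      ((Fin.forall_iff_succAbove i.succ).2 (by simp [hp]))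
      ((Fin.forall_iff_succAbove i.succ).2 ⟨by simpa using hb, fun j => by
        by_cases hj : j = i
        · subst hj
          simpa only [Fin.insertNth_apply_succAbove, Function.update_self] using ha
        · simpa only [Fin.insertNth_apply_succAbove, Function.update_of_ne hj] using hz j⟩)
    refine gamma_antitone L ?_ h
    rw [Fin.sum_univ_succAbove _ i.succ]
    have := hp i
    simp only [Fin.insertNth_apply_same, Fin.insertNth_apply_succAbove]
    omega
  have hsmall {a : L} (ha : a ∈ gamma L (p i + 1)) :
      φ (Function.update z i a) ∈ gamma L (∑ j, p j + 1) := by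
    have h := hφ.1 (Function.update p i (p i + 1)) (Function.update z i a)
      (fun j => by
        by_cases hj : j = i
        · subst hj; simp
        · simp [hj, hp])
      (fun j => by
        by_cases hj : j = i
        · subst hj; simpa using ha
        · simpa [hj] using hz j)
    refine gamma_antitone L ?_ h
    rw [Finset.sum_update_of_mem (Finset.mem_univ i), Finset.sdiff_singleton_eq_erase,
      ← Finset.add_sum_erase _ _ (Finset.mem_univ i)]
    omega
  have hN := isNormalSubloop_gamma L (p i)
  have hcl {v : L} (hv : SubloopClosure S v) :
      φ (Function.update z i v) ∈ spanMod T (∑ j, p j) := by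
    induction hv with
    | of h => exact H _ h
    | one => exact gamma_subset_spanMod (hsmall (isNormalSubloop_gamma L _).one_mem)
    | mul h h' ih ih' =>
      exact spanMod_congr (hadd (h.mem hN hS) (h'.mem hN hS)) (mul_mem_spanMod ih ih')
    | ldiv h h' ih ih' =>
      have e := hadd (h.mem hN hS) ((h.ldiv h').mem hN hS)
      rw [mul_ldiv, map_mul] at e
      refine spanMod_congr ?_ (ldiv_mem_spanMod ih ih')
      rw [map_ldiv, eq_ldiv_of_mul_eq e]
    | div h h' ih ih' =>
      have e := hadd ((h.div h').mem hN hS) (h'.mem hN hS)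
      rw [div_mul, map_mul] at e
      refine spanMod_congr ?_ (div_mem_spanMod ih ih')
      rw [map_div, eq_div_of_mul_eq e]
  obtain ⟨v, hv, e⟩ := hS' ha
  have ht := gammaProj_eq_iff.1 e
  have h := hadd (hv.mem hN hS) (gamma_antitone L (Nat.le_succ _) ht)
  rw [mul_ldiv] at h
  exact spanMod_congr h (mul_mem_spanMod (hcl hv) (gamma_subset_spanMod (hsmall ht)))

/-- To find the values of a regular function modulo the next term of the filtration, it is enough
to know them at generators of the graded pieces. -/
theorem IsRegular.mem_spanMod {k : ℕ} {φ : (Fin k → L) → L} (hφ : IsRegular φ)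
    {p : Fin k → ℕ} (hp : ∀ j, 1 ≤ p j) {S : Fin k → Set L} (hS : ∀ j, S j ⊆ gamma L (p j))
    (hS' : ∀ j, gamma L (p j) ⊆ spanMod (S j) (p j)) {T : Set L}
    (H : ∀ z, (∀ j, z j ∈ S j) → φ z ∈ spanMod T (∑ j, p j)) {z : Fin k → L}
    (hz : ∀ j, z j ∈ gamma L (p j)) : φ z ∈ spanMod T (∑ j, p j) := by
  -- The arguments that are not restricted to generators form a finite set `J`.
  suffices ∀ (J : Finset (Fin k)) (z : Fin k → L), (∀ j, z j ∈ gamma L (p j)) →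
      (∀ j ∉ J, z j ∈ S j) → φ z ∈ spanMod T (∑ j, p j) from
    this Finset.univ z hz (by simp)
  intro J
  induction J using Finset.induction_on with
  | empty => exact fun z _ h => H z (by simpa using h)
  | insert i J _ ih =>
    intro z hz h
    rw [← Function.update_eq_self i z]
    refine hφ.update_mem_spanMod hp (hS i) (hS' i) hz (fun s hs => ih _ ?_ ?_) (hz i)
    · intro j
      by_cases hj : j = i
      · subst hj; simpa using hS j hs
      · simpa [hj] using hz j
    · intro j hjJ
      by_cases hj : j = i
      · subst hj; simpa using hs
      · simpa [hj] using h j (by simp [hj, hjJ])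

theorem mul_mul_mul_comm_of_isMulCentral {a b c d : L} (ha : IsMulCentral a)
    (hb : IsMulCentral b) (hc : IsMulCentral c) (hd : IsMulCentral d) :
    a * b * (c * d) = a * c * (b * d) :=
  congrArg Subtype.val (mul_mul_mul_comm (⟨a, ha⟩ : Subsemigroup.center L) ⟨b, hb⟩ ⟨c, hc⟩ ⟨d, hd⟩)

/-- Modulo `gamma L (n + 1)`, an element of the subloop generated by a union of two subsets
of `gamma L n` is a product of elements of the subloops generated by these subsets. -/
theorem SubloopClosure.exists_mul_of_union {n : ℕ} (hn : 1 ≤ n) {S T : Set L}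
    (hS : S ⊆ gamma L n) (hT : T ⊆ gamma L n) {z : L} (hz : SubloopClosure (S ∪ T) z) :
    ∃ a b, SubloopClosure S a ∧ SubloopClosure T b ∧
      gammaProj L (n + 1) z = gammaProj L (n + 1) (a * b) := by
  have hN := isNormalSubloop_gamma L n
  have exch {a b c d : L} (ha : SubloopClosure S a) (hb : SubloopClosure T b)
      (hc : SubloopClosure S c) (hd : SubloopClosure T d) :
      gammaProj L (n + 1) (a * b * (c * d)) = gammaProj L (n + 1) (a * c * (b * d)) := by
    simpa using mul_mul_mul_comm_of_isMulCentral (isMulCentral_gammaProj hn (ha.mem hN hS))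
      (isMulCentral_gammaProj hn (hb.mem hN hT)) (isMulCentral_gammaProj hn (hc.mem hN hS))
      (isMulCentral_gammaProj hn (hd.mem hN hT))
  induction hz with
  | of h =>
    rcases h with h | h
    · exact ⟨_, 1, .of h, .one, by simp⟩
    · exact ⟨1, _, .one, .of h, by simp⟩
  | one => exact ⟨1, 1, .one, .one, by simp⟩
  | mul _ _ ih ih' =>
    obtain ⟨a, b, ha, hb, e⟩ := ih
    obtain ⟨c, d, hc, hd, e'⟩ := ih'
    exact ⟨_, _, ha.mul hc, hb.mul hd, by
      rw [← exch ha hb hc hd, map_mul, e, e', map_mul _ (a * b)]⟩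
  | ldiv _ _ ih ih' =>
    obtain ⟨a, b, ha, hb, e⟩ := ih
    obtain ⟨c, d, hc, hd, e'⟩ := ih'
    refine ⟨_, _, ha.ldiv hc, hb.ldiv hd, ?_⟩
    rw [map_ldiv, e, e']
    refine (eq_ldiv_of_mul_eq ?_).symm
    rw [← map_mul, exch ha hb (ha.ldiv hc) (hb.ldiv hd), mul_ldiv, mul_ldiv]
  | div _ _ ih ih' =>
    obtain ⟨a, b, ha, hb, e⟩ := ih
    obtain ⟨c, d, hc, hd, e'⟩ := ih'
    refine ⟨_, _, ha.div hc, hb.div hd, ?_⟩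
    rw [map_div, e, e']
    refine (eq_div_of_mul_eq ?_).symm
    rw [← map_mul, exch (ha.div hc) (hb.div hd) hc hd, div_mul, div_mul]

end Loop

open Loop

namespace FreeLoop

variable {X : Type*} {L M : Type*} [Loop L] [Loop M]

/-! ### Bracket monomials in the free loop -/

theorem map_lift (h : L →* M) (f : X → L) (w : FreeLoop X) : h (lift f w) = lift (h ∘ f) w := by
  obtain ⟨t⟩ := w
  change h (t.eval f) = t.eval (h ∘ f)
  induction t with
  | of x => rfl
  | one => exact map_one h
  | mul a b iha ihb => simp [LoopTerm.eval, iha, ihb]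
  | ldiv a b iha ihb => simp [LoopTerm.eval, map_ldiv, iha, ihb]
  | rdiv a b iha ihb => simp [LoopTerm.eval, Loop.map_div, iha, ihb]

/-- `IsMonomial s z` says that `z` is obtained from the generators of the free loop by iterating
commutators and associator deviations, and that the multiset `s` lists the generators used, with
their multiplicities. -/
inductive IsMonomial : Multiset X → FreeLoop X → Prop
  | of (x : X) : IsMonomial {x} (of x)
  | commutator {s t a b} : IsMonomial s a → IsMonomial t b → IsMonomial (s + t) (commutator a b)
  | associatorDeviation {l} (α : (j : Fin l) → Fin ((j : ℕ) + 3)) {s : Fin (l + 3) → Multiset X}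
      {x : Fin (l + 3) → FreeLoop X} : (∀ j, IsMonomial (s j) (x j)) →
      IsMonomial (∑ j, s j) (associatorDeviation l α x)

/-- A monomial maps into the term of the filtration given by the total weight of its letters. -/
theorem IsMonomial.map_mem_gamma (h : FreeLoop X →* L) {n : X → ℕ} (hn : ∀ x, 1 ≤ n x)
    (hx : ∀ x, h (FreeLoop.of x) ∈ gamma L (n x)) {s : Multiset X} {z : FreeLoop X}
    (hz : IsMonomial s z) : 1 ≤ (s.map n).sum ∧ h z ∈ gamma L (s.map n).sum := by
  induction hz with
  | of x => simpa using ⟨hn x, hx x⟩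
  | commutator _ _ iha ihb =>
    rw [Multiset.map_add, Multiset.sum_add, map_commutator]
    exact ⟨by omega, commutator_mem_gamma iha.1 ihb.1 iha.2 ihb.2⟩
  | @associatorDeviation l α s x _ ih =>
    have e : ((∑ j, s j).map n).sum = ∑ j, ((s j).map n).sum :=
      map_sum (Multiset.sumAddMonoidHom.comp (Multiset.mapAddMonoidHom n)) _ _
    rw [e, map_associatorDeviation]
    refine ⟨(ih 0).1.trans (Finset.single_le_sum (f := fun j => ((s j).map n).sum)
      (fun _ _ => Nat.zero_le _) (Finset.mem_univ 0)), ?_⟩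
    exact respectsFiltration_associatorDeviation l α _ _ (fun j => (ih j).1) fun j => (ih j).2

theorem IsMonomial.mem_gamma {s : Multiset X} {z : FreeLoop X} (hz : IsMonomial s z) :
    z ∈ gamma (FreeLoop X) s.card := by
  simpa using (hz.map_mem_gamma (MonoidHom.id _) (n := fun _ => 1) (by simp)
    (fun x => mem_gamma_one _)).2

/-- The monomials of degree `n` in which every letter from `A` occurs. -/
def monomials (A : Finset X) (n : ℕ) : Set (FreeLoop X) :=
  {z | ∃ s : Multiset X, s.card = n ∧ (∀ x ∈ A, x ∈ s) ∧ IsMonomial s z}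

theorem monomials_subset_gamma (A : Finset X) (n : ℕ) :
    monomials A n ⊆ gamma (FreeLoop X) n := by
  rintro z ⟨s, rfl, -, hz⟩
  exact hz.mem_gamma

/-- The graded pieces of the filtration of a free loop are generated by the monomials. -/
theorem gamma_subset_spanMod_monomials (n : ℕ) (hn : 1 ≤ n) :
    gamma (FreeLoop X) n ⊆ spanMod (monomials ∅ n) n := by
  induction n using Nat.strong_induction_on with
  | _ n ih =>
  obtain rfl | hn' := hn.eq_or_lt
  · rintro ⟨t⟩ -
    induction t with
    | of x => exact subset_spanMod ⟨{x}, by simp, by simp, .of x⟩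
    | one => exact ⟨1, .one, rfl⟩
    | mul a b iha ihb => exact mul_mem_spanMod iha ihb
    | ldiv a b iha ihb => exact ldiv_mem_spanMod iha ihb
    | rdiv a b iha ihb => exact div_mem_spanMod iha ihb
  · refine gamma_subset hn' (isNormalSubloop_spanMod hn (monomials_subset_gamma _ _)) ?_ ?_
    · intro p q hp hq hpq a ha b hb
      obtain rfl | hlt := hpq.eq_or_lt
      · have h := isRegular_commutator (L := FreeLoop X) |>.mem_spanMod (p := ![p, q])
          (S := ![monomials ∅ p, monomials ∅ q]) (T := monomials ∅ (p + q)) (z := ![a, b])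
          (by simp [Fin.forall_fin_two, hp.1, hq.1])
          (by simp [Fin.forall_fin_two, monomials_subset_gamma])
          (by simp [Fin.forall_fin_two, ih p hp.2 hp.1, ih q hq.2 hq.1]) ?_
          (by simp [Fin.forall_fin_two, ha, hb])
        · simpa using h
        · intro z hz
          obtain ⟨⟨s, hs, -, hsz⟩, ⟨t, ht, -, htz⟩⟩ := Fin.forall_fin_two.1 hz
          rw [Fin.sum_univ_two]
          exact subset_spanMod ⟨s + t, by simp [hs, ht], by simp, hsz.commutator htz⟩
      · exact gamma_subset_spanMod (commutator_mem_gamma_of_lt (by omega) (by omega) hlt ha hb)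
    · intro l α p hp hpn x hx
      obtain rfl | hlt := hpn.eq_or_lt
      · refine (isRegular_associatorDeviation l α).mem_spanMod (fun j => (hp j).1)
          (fun j => monomials_subset_gamma ∅ (p j)) (fun j => ih _ (hp j).2 (hp j).1) ?_ hx
        intro z hz
        choose s hs _ hsz using hz
        exact subset_spanMod ⟨_, by simp [hs], by simp, .associatorDeviation α hsz⟩
      · exact gamma_subset_spanMod (associatorDeviation_mem_gamma_of_lt α
          (fun j => ⟨(hp j).1, (hp j).2.trans n.lt_succ_self⟩) hlt hx)

/-! ### Killing letters -/

variable [DecidableEq X]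

/-- The endomorphism of the free loop that sends the generator `x` to `1` and fixes all other
generators. -/
def kill (x : X) : FreeLoop X →* FreeLoop X :=
  lift (Function.update of x 1)

theorem IsMonomial.kill {s : Multiset X} {z : FreeLoop X} (hz : IsMonomial s z) (x : X) :
    (x ∈ s → kill x z = 1) ∧ (x ∉ s → kill x z = z) := by
  induction hz with
  | of y =>
    have e : FreeLoop.kill x (FreeLoop.of y) = Function.update FreeLoop.of x 1 y := rfl
    rw [e]
    by_cases h : y = x
    · subst h; simp
    · simp [h, Ne.symm h]
  | @commutator s t a b _ _ iha ihb =>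
    rw [map_commutator, Multiset.mem_add, not_or]
    refine ⟨fun h => commutator_eq_one_iff.2 ?_, fun h => by rw [iha.2 h.1, ihb.2 h.2]⟩
    rcases h with h | h
    · simp [iha.1 h]
    · simp [ihb.1 h]
  | @associatorDeviation l α s z _ ih =>
    rw [map_associatorDeviation]
    simp only [Multiset.mem_sum, Finset.mem_univ, true_and, not_exists]
    refine ⟨fun ⟨j, hj⟩ => associatorDeviation_eq_one l α _ j ((ih j).1 hj), fun h => ?_⟩
    congr 1
    exact funext fun j => (ih j).2 (h j)

theorem kill_eq_one_of_subloopClosure {S : Set (FreeLoop X)} {x : X} (hS : ∀ z ∈ S, kill x z = 1)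
    {z : FreeLoop X} (hz : SubloopClosure S z) : kill x z = 1 := by
  induction hz with
  | of h => exact hS _ h
  | one => exact map_one _
  | mul _ _ h h' => simp [h, h']
  | ldiv _ _ h h' => simp [map_ldiv, h, h']
  | div _ _ h h' => simp [Loop.map_div, h, h']

theorem kill_eq_self_of_subloopClosure {S : Set (FreeLoop X)} {x : X}
    (hS : ∀ z ∈ S, kill x z = z) {z : FreeLoop X} (hz : SubloopClosure S z) : kill x z = z := by
  induction hz with
  | of h => exact hS _ h
  | one => exact map_one _
  | mul _ _ h h' => simp [h, h']
  | ldiv _ _ h h' => simp [map_ldiv, h, h']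
  | div _ _ h h' => simp [Loop.map_div, h, h']

/-- An element of the `n`-th term of the filtration of a free loop that is killed modulo the next
term by setting any letter from `A` to `1` is, modulo the next term, in the subloop generated by
the monomials of degree `n` in which all letters from `A` occur. -/
theorem mem_spanMod_monomials_of_kill {n : ℕ} (hn : 1 ≤ n) {u : FreeLoop X}
    (hu : u ∈ gamma (FreeLoop X) n) (A : Finset X)
    (hA : ∀ x ∈ A, kill x u ∈ gamma (FreeLoop X) (n + 1)) : u ∈ spanMod (monomials A n) n := by
  induction A using Finset.induction_on with
  | empty => exact gamma_subset_spanMod_monomials n hn hu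
  | insert x A _ ih =>
    obtain ⟨v, hv, e⟩ := ih fun y hy => hA y (Finset.mem_insert_of_mem hy)
    -- Separate the monomials that contain `x` from those that do not. Setting `x` to `1` kills
    -- the former and fixes the latter, so the contribution of the latter is trivial.
    set T : Set (FreeLoop X) := {z | z ∈ monomials A n ∧ kill x z = z}
    have hST : monomials A n = monomials (insert x A) n ∪ T := by
      ext z
      constructor
      · rintro ⟨s, hs, hsA, hz⟩
        by_cases hxs : x ∈ s
        · exact .inl ⟨s, hs, by simpa [hxs] using hsA, hz⟩
        · exact .inr ⟨⟨s, hs, hsA, hz⟩, (hz.kill x).2 hxs⟩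
      · rintro (⟨s, hs, hsA, hz⟩ | h)
        · exact ⟨s, hs, fun y hy => hsA y (Finset.mem_insert_of_mem hy), hz⟩
        · exact h.1
    rw [hST] at hv
    obtain ⟨a, b, ha, hb, e'⟩ := hv.exists_mul_of_union hn (monomials_subset_gamma _ _)
      fun z hz => monomials_subset_gamma _ _ hz.1
    have ka : kill x a = 1 := by
      refine kill_eq_one_of_subloopClosure ?_ ha
      rintro z ⟨s, -, hs, hz⟩
      exact (hz.kill x).1 (hs x (Finset.mem_insert_self x A))
    have kb : kill x b = b := kill_eq_self_of_subloopClosure (fun z hz => hz.2) hb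
    have hb1 : gammaProj (FreeLoop X) (n + 1) b = 1 := by
      have h := gammaProj_map (kill x) (e'.symm.trans e)
      rwa [map_mul, ka, kb, one_mul,
        gammaProj_eq_one_iff.2 (hA x (Finset.mem_insert_self x A))] at h
    exact ⟨a, ha, by rw [← e, e', map_mul, hb1, mul_one]⟩

/-- If an element of a free loop of finite rank becomes arbitrarily deep in the filtration as soon
as any letter is set to `1`, then the function that it induces respects the filtration. -/
theorem lift_mem_gamma_of_kill [Fintype X] {u : FreeLoop X}
    (hu : ∀ x N, kill x u ∈ gamma (FreeLoop X) N) {f : X → L} {n : X → ℕ} (hn : ∀ x, 1 ≤ n x)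
    (hf : ∀ x, f x ∈ gamma L (n x)) : lift f u ∈ gamma L (∑ x, n x) := by
  suffices ∀ d r : ℕ, 1 ≤ r → ∑ x, n x ≤ r + d → ∀ u ∈ gamma (FreeLoop X) r,
      (∀ x N, kill x u ∈ gamma (FreeLoop X) N) → lift f u ∈ gamma L (∑ x, n x) from
    this _ 1 le_rfl (Nat.le_add_left _ _) u (mem_gamma_one u) hu
  intro d
  induction d with
  | zero => exact fun r _ hr u h _ => gamma_antitone L hr (Loop.map_mem_gamma (lift f) r u h)
  | succ d ih =>
    intro r hr hrd u hur hu
    obtain ⟨v, hv, e⟩ :=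
      mem_spanMod_monomials_of_kill hr hur Finset.univ fun x _ => hu x (r + 1)
    have hfv : lift f v ∈ gamma L (∑ x, n x) := by
      have hN := (isNormalSubloop_gamma L (∑ x, n x)).preimage (lift f)
      refine hv.mem hN ?_
      rintro z ⟨s, -, hs, hz⟩
      refine gamma_antitone L ?_ (hz.map_mem_gamma (lift f) hn hf).2
      have hle : (Finset.univ : Finset X).val ≤ s :=
        (Multiset.le_iff_subset Finset.univ.nodup).2 fun x hx => hs x hx
      obtain ⟨t, rfl⟩ := Multiset.le_iff_exists_add.1 hle
      rw [Multiset.map_add, Multiset.sum_add]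
      exact Nat.le_add_right _ _
    have hkv (x : X) : kill x v = 1 := by
      refine kill_eq_one_of_subloopClosure ?_ hv
      rintro z ⟨s, -, hs, hz⟩
      exact (hz.kill x).1 (hs x (Finset.mem_univ x))
    rw [← mul_ldiv v u, map_mul]
    refine (isNormalSubloop_gamma L _).mul_mem hfv
      (ih (r + 1) (by omega) (by omega) _ (gammaProj_eq_iff.1 e) fun x N => ?_)
    rw [map_ldiv, hkv, one_ldiv]
    exact hu x N

end FreeLoop

/-! ### Functions induced by words -/

/-- If `wordFun w` respects the filtration, then its deviations are arbitrarily deep in the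
filtration as soon as one of their arguments is trivial. -/
theorem deviation_wordFun_mem_gamma {k : ℕ} {w : FreeLoop (Fin k)} {L : Type*} [Loop L]
    (hw : RespectsFiltration (wordFun w L)) (i : Fin k) {x : Fin (k + 1) → L} {j : Fin (k + 1)}
    (hj : x j = 1) (N : ℕ) : deviation (wordFun w L) i x ∈ gamma L N := by
  have hN := isNormalSubloop_gamma L (N + 1)
  -- Modulo `gamma L (N + 1)`, the function `wordFun w` vanishes whenever an argument does.
  have H (y : Fin k → hN.Quotient) (j : Fin k) (hy : y j = 1) :
      wordFun w hN.Quotient y = 1 := by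
    choose z hz using fun j => hN.proj_surjective (y j)
    obtain rfl : hN.proj ∘ z = y := funext hz
    rw [wordFun, ← FreeLoop.map_lift, hN.proj_eq_one_iff]
    set m : Fin k → ℕ := Function.update (fun _ => 1) j (N + 1)
    have hm : m j = N + 1 := Function.update_self ..
    have hm' {a : Fin k} (ha : a ≠ j) : m a = 1 := Function.update_of_ne ha ..
    have h := hw m z
      (fun a => by
        by_cases ha : a = j
        · subst ha; omega
        · rw [hm' ha])
      (fun a => by
        by_cases ha : a = j
        · subst ha; rw [hm]; exact hN.proj_eq_one_iff.1 hy
        · rw [hm' ha]; exact mem_gamma_one _)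
    refine gamma_antitone L ?_ h
    rw [← hm]
    exact Finset.single_le_sum (fun _ _ => Nat.zero_le _) (Finset.mem_univ j)
  refine gamma_succ_subset N ?_
  rw [← hN.proj_eq_one_iff, map_deviation (φ := wordFun w L) (ψ := wordFun w hN.Quotient)
    hN.proj (FreeLoop.map_lift hN.proj · w)]
  exact deviation_eq_one H i (j := j) (by simp [hj])

theorem mainTheorem4 {k : ℕ} (w : FreeLoop (Fin k))
    (hw : ∀ (L : Type u) [Loop L], Loop.RespectsFiltration (wordFun w L)) :
    ∀ (L : Type u) [Loop L], Loop.IsRegular (wordFun w L) := by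
  refine fun L _ => ⟨hw L, fun i n x hn hx => ?_⟩
  -- The deviation is itself induced by an element `d` of the free loop. Its letters are lifted to
  -- the universe of `L`, so that the hypothesis applies to the free loop.
  set X := ULift.{u} (Fin (k + 1))
  set g : Fin (k + 1) → FreeLoop X := fun j => .of ⟨j⟩
  set d : FreeLoop X := deviation (wordFun w (FreeLoop X)) i g
  have hd {M : Type u} [Loop M] (h : FreeLoop X →* M) :
      h d = deviation (wordFun w M) i (h ∘ g) :=
    map_deviation h (FreeLoop.map_lift h · w) i g
  have e : FreeLoop.lift (x ∘ ULift.down) d = deviation (wordFun w L) i x := hd _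
  rw [← e, ← Equiv.ulift.sum_comp n]
  refine FreeLoop.lift_mem_gamma_of_kill (fun y N => ?_) (fun _ => hn _) fun _ => hx _
  rw [hd]
  exact deviation_wordFun_mem_gamma (hw _) i (j := y.down) (Function.update_self y 1 _) N
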